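/- Identify $\{-1,1\}^{\omega}$ with infinite binary strings. A \emph{prefix-free machine} is a partial recursive function $M:\{-1,1\}^*\rightharpoonup\{-1,1\}^*$ whose domain contains no two strings one of which is a proper initial segment of the other; $K_M(a)$ denotes the least length of a $p$ with $M(p)=a$ (and $\infty$ if there is none). Let $U$ be a universal prefix-free machine, i.e. a prefix-free machine such that for every prefix-free machine $M$ there is a constant $c$ with $K_U\le K_M+c$, and write $K=K_U$. A string $\alpha=\alpha_0\alpha_1\dots\in\{-1,1\}^{\omega}$ is \emph{Kolmogorov--Chaitin complex} ($\alpha\in KC$) if there is a $k$ such that $K(\alpha_0\dots\alpha_{n-1})\ge n-k$ for all $n$. An \emph{algorithmically random Rademacher sequence} is a sequence $(\varepsilon_n)_{n\ge 0}$ of real numbers such that, for some $\alpha\in KC$, $\varepsilon_n=\alpha_n$ for all $n$. A sequence $(u_n)_{n\ge 0}$ of real numbers is \emph{computable} if there is a computable double sequence of rational numbers $(r_{n,m})$ with $|r_{n,m}-u_n|\le 2^{-m}$ for all $n,m$. It is \emph{square computable} if it is computable, $\sum_{k} u_k^2<\infty$, and there is a computable function $N:\mathbb{N}\to\mathbb{N}$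 such that for every integer $m\ge 1$ $$\left|\sum_{k=0}^{\infty}u_k^2-\sum_{k<N(m)}u_k^2\right|<\frac1m .$$ \textbf{Theorem.} Let $(u_n)_{n\ge 0}$ be a square computable sequence of real numbers and let $(\varepsilon_n)_{n\ge 0}$ be an algorithmically random Rademacher sequence. Then the series $\sum_{n}\varepsilon_n u_n$ converges in $\mathbb{R}$ (i.e. its sequence of partial sums converges). -/

import Mathlib

open Filter Topology

/-! ### Prefix-free Kolmogorov complexity

Finite strings over the two-letter alphabet `{-1, 1}` are lists of Booleans and elements of
`{-1, 1} ^ ω` are functions `ℕ → Bool`; the letter `true` stands for `1` and `false` for `-1`. -/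

/-- A prefix-free machine: a partial recursive function on finite binary strings whose domain
contains no two strings one of which is a proper initial segment of the other. -/
structure IsPrefixMachine (M : List Bool →. List Bool) : Prop where
  partrec : Partrec M
  prefixFree : ∀ p q, (M p).Dom → (M q).Dom → p <+: q → p = q

/-- The complexity of the string `σ` with respect to the machine `M`: the least length of a program
`p` on which `M` halts with output `σ`, and `⊤` if there is none. -/
noncomputable def complexity (M : List Bool →. List Bool) (σ : List Bool) : ℕ∞ :=
  ⨅ (p : List Bool) (_ : σ ∈ M p), (p.length : ℕ∞)

/-- A universal prefix-free machine, which serves as reference machine for Kolmogorov complexity: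
a prefix-free machine that is optimal up to an additive constant among prefix-free machines. -/
structure IsUniversalPrefixMachine (U : List Bool →. List Bool) : Prop where
  isPrefixMachine : IsPrefixMachine U
  optimal : ∀ M, IsPrefixMachine M → ∃ c : ℕ, ∀ σ, complexity U σ ≤ complexity M σ + c

/-- The initial segment of length `n` of the infinite string `α`. -/
def initialSegment (α : ℕ → Bool) (n : ℕ) : List Bool :=
  (List.range n).map α

/-- The set of Kolmogorov–Chaitin complex strings, where Kolmogorov complexity is taken with respect
to the reference machine `U`: those `α` for which there is `k` such that the initial segment
of every length `n` has complexity at least `n - k`. -/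
def KC (U : List Bool →. List Bool) : Set (ℕ → Bool) :=
  {α | ∃ k : ℕ, ∀ n : ℕ, (n : ℕ∞) ≤ complexity U (initialSegment α n) + k}

/-! ### Rademacher sequences and computable sequences of reals -/

/-- The Rademacher sequence determined by `α`: the `n`-th letter of `α`, as a real number. -/
def rademacher (α : ℕ → Bool) (n : ℕ) : ℝ :=
  if α n then 1 else -1

/-- An algorithmically random Rademacher sequence: the letters of some Kolmogorov–Chaitin complex
string. -/
def IsAlgorithmicallyRandomRademacher (U : List Bool →. List Bool) (ε : ℕ → ℝ) : Prop :=
  ∃ α ∈ KC U, ∀ n, ε n = rademacher α n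

/-- A computable sequence of real numbers: there is a computable double sequence of rational numbers
`(-1) ^ s n m * a n m / b n m` such that the `m`-th one approximates `x n` up to `2 ^ (-m)`. -/
def IsComputableRealSeq (x : ℕ → ℝ) : Prop :=
  ∃ s a b : ℕ → ℕ → ℕ, Computable₂ s ∧ Computable₂ a ∧ Computable₂ b ∧
    ∀ n m, b n m ≠ 0 ∧ |(-1 : ℝ) ^ s n m * (a n m : ℝ) / (b n m : ℝ) - x n| ≤ 1 / 2 ^ m

/-- A square computable sequence: a computable sequence of real numbers whose squares have a finite
sum, together with an effective procedure that finds, given a positive integer `m`, a number of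
terms whose partial sum approximates the sum up to `1 / m`. -/
def IsSquareComputable (x : ℕ → ℝ) : Prop :=
  IsComputableRealSeq x ∧ Summable (fun k => x k ^ 2) ∧
    ∃ N : ℕ → ℕ, Computable N ∧
      ∀ m : ℕ, 1 ≤ m → |(∑' k, x k ^ 2) - ∑ k ∈ Finset.range (N m), x k ^ 2| < 1 / (m : ℝ)

/-! ### Existence of a universal prefix-free machine

The machine reads `1 ^ e (-1) σ` and runs on `σ` the `e`-th partial recursive function, modified so
that its domain becomes prefix-free. -/

namespace UniversalMachine

open Nat.Partrec (Code)
open Encodable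

/-- Whether one of two strings is an initial segment of the other. -/
def comparable (σ τ : List Bool) : Bool :=
  decide (σ.take τ.length = τ.take σ.length)

/-- The `n`-th entry in the enumeration of the graph of the function with code `c`. -/
def stage (c : Code) (n : ℕ) : Option (List Bool × ℕ) :=
  (decode (α := List Bool) n.unpair.2).bind fun τ =>
    (Code.evaln n.unpair.1 c (encode τ)).map fun y => (τ, y)

/-- Whether the `n`-th entry of the enumeration exists and has an input comparable with `σ`. -/
def hit (c : Code) (σ : List Bool) (n : ℕ) : Bool :=
  Option.casesOn (stage c n) false fun t => comparable t.1 σ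

/-- The output at stage `n`, provided that the input of this stage is `σ`. -/
def output (c : Code) (σ : List Bool) (n : ℕ) : Option (List Bool) :=
  (stage c n).bind fun t => bif decide (t.1 = σ) then decode t.2 else none

/-- The prefix-free modification of the machine with code `c`. -/
def trim (c : Code) (σ : List Bool) : Part (List Bool) :=
  (Nat.rfind fun n => Part.some (hit c σ n)).bind fun n => (output c σ n : Part (List Bool))

/-- The universal machine. -/
def machine (p : List Bool) : Part (List Bool) :=
  bif decide (p.idxOf false < p.length) then
    trim (Denumerable.ofNat Code (p.idxOf false)) (p.drop (p.idxOf false + 1))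
  else Part.none

theorem comparable_comm {σ τ : List Bool} : comparable σ τ = comparable τ σ := by
  simp only [comparable, eq_comm]

theorem comparable_of_prefix {σ τ : List Bool} (h : σ <+: τ) : comparable σ τ = true := by
  obtain ⟨t, rfl⟩ := h
  simp [comparable]

theorem prefix_of_comparable {σ τ : List Bool} (h : comparable σ τ = true) :
    σ <+: τ ∨ τ <+: σ := by
  simp only [comparable, decide_eq_true_eq] at h
  rcases le_total σ.length τ.length with hl | hl
  · left
    rw [List.take_of_length_le hl] at h
    rw [h]; exact List.take_prefix _ _
  · right
    rw [List.take_of_length_le hl] at h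
    rw [← h]; exact List.take_prefix _ _

theorem comparable_primrec : Primrec₂ comparable :=
  Primrec.eq.decide.comp
    (Primrec.list_take.comp (Primrec.list_length.comp Primrec.snd) Primrec.fst)
    (Primrec.list_take.comp (Primrec.list_length.comp Primrec.fst) Primrec.snd)

theorem stage_primrec : Primrec₂ stage := by
  refine Primrec.option_bind
    (Primrec.decode.comp (Primrec.snd.comp (Primrec.unpair.comp Primrec.snd))) ?_
  refine Primrec.option_map (Code.primrec_evaln.comp
    (((Primrec.fst.comp (Primrec.unpair.comp (Primrec.snd.comp Primrec.fst))).pair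
      (Primrec.fst.comp Primrec.fst)).pair (Primrec.encode.comp Primrec.snd))) ?_
  exact (Primrec.snd.comp Primrec.fst).pair Primrec.snd

theorem hit_primrec : Primrec fun x : (Code × List Bool) × ℕ => hit x.1.1 x.1.2 x.2 := by
  refine Primrec.option_casesOn
    (stage_primrec.comp (Primrec.fst.comp Primrec.fst) Primrec.snd) (Primrec.const false) ?_
  exact comparable_primrec.comp (Primrec.fst.comp Primrec.snd)
    (Primrec.snd.comp (Primrec.fst.comp Primrec.fst))

theorem output_primrec : Primrec fun x : (Code × List Bool) × ℕ => output x.1.1 x.1.2 x.2 := by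
  refine Primrec.option_bind
    (stage_primrec.comp (Primrec.fst.comp Primrec.fst) Primrec.snd) ?_
  exact Primrec.cond (Primrec.eq.decide.comp (Primrec.fst.comp Primrec.snd)
      (Primrec.snd.comp (Primrec.fst.comp Primrec.fst)))
    (Primrec.decode.comp (Primrec.snd.comp Primrec.snd)) (Primrec.const none)

theorem trim_partrec : Partrec fun x : Code × List Bool => trim x.1 x.2 :=
  Partrec.bind (Partrec.rfind (p := fun (x : Code × List Bool) n => Part.some (hit x.1 x.2 n))
      hit_primrec.to_comp.partrec)
    (Computable.ofOption output_primrec.to_comp)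

theorem machine_partrec : Partrec machine := by
  have hi : Primrec fun p : List Bool => p.idxOf false :=
    Primrec.list_idxOf.comp (Primrec.const false) Primrec.id
  have hg : Computable fun p : List Bool =>
      (Denumerable.ofNat Code (p.idxOf false), p.drop (p.idxOf false + 1)) :=
    (((Primrec.ofNat Code).comp hi).pair
      (Primrec.list_drop.comp (Primrec.succ.comp hi) Primrec.id)).to_comp
  have ht := Partrec.comp trim_partrec hg
  have hc : Computable fun p : List Bool => decide (p.idxOf false < p.length) :=
    (Primrec.nat_lt.decide.comp hi Primrec.list_length).to_comp
  exact Partrec.cond hc ht Partrec.none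

theorem mem_trim {c : Code} {σ y : List Bool} : y ∈ trim c σ ↔
    ∃ n, hit c σ n = true ∧ (∀ m < n, hit c σ m = false) ∧ y ∈ output c σ n := by
  simp only [trim, Part.mem_bind_iff, Part.mem_ofOption]
  have hr : ∀ n, n ∈ (Nat.rfind fun n => Part.some (hit c σ n)) ↔
      true ∈ Part.some (hit c σ n) ∧ ∀ {m : ℕ}, m < n → false ∈ Part.some (hit c σ m) :=
    fun n => Nat.mem_rfind (p := fun n => Part.some (hit c σ n))
  simp only [hr, Part.mem_some_iff]
  constructor
  · rintro ⟨n, ⟨h1, h2⟩, h3⟩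
    exact ⟨n, h1.symm, fun m hm => (h2 hm).symm, h3⟩
  · rintro ⟨n, h1, h2, h3⟩
    exact ⟨n, ⟨h1.symm, fun hm => (h2 _ hm).symm⟩, h3⟩

theorem hit_eq {c : Code} {σ : List Bool} {n : ℕ} : hit c σ n = true ↔
    ∃ t, stage c n = some t ∧ comparable t.1 σ = true := by
  unfold hit; cases stage c n <;> simp

theorem mem_output {c : Code} {σ y : List Bool} {n : ℕ} : y ∈ output c σ n ↔
    ∃ z, stage c n = some (σ, z) ∧ decode z = some y := by
  unfold output
  rcases stage c n with _ | ⟨τ, z⟩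
  · simp
  · by_cases h : τ = σ <;> simp [h]

theorem trim_prefixFree (c : Code) (σ τ : List Bool) (hσ : (trim c σ).Dom) (hτ : (trim c τ).Dom)
    (h : σ <+: τ) : σ = τ := by
  obtain ⟨y, hy⟩ := Part.dom_iff_mem.1 hσ
  obtain ⟨z, hz⟩ := Part.dom_iff_mem.1 hτ
  obtain ⟨n, -, hn, hyn⟩ := mem_trim.1 hy
  obtain ⟨m, -, hm, hzm⟩ := mem_trim.1 hz
  obtain ⟨a, ha, -⟩ := mem_output.1 hyn
  obtain ⟨b, hb, -⟩ := mem_output.1 hzm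
  have hc := comparable_of_prefix h
  rcases lt_trichotomy n m with hlt | rfl | hlt
  · exact absurd (hit_eq.2 ⟨_, ha, hc⟩) (by simp [hm n hlt])
  · rw [ha] at hb
    simp only [Option.some.injEq, Prod.mk.injEq] at hb
    exact hb.1
  · exact absurd (hit_eq.2 ⟨_, hb, comparable_comm.trans hc⟩) (by simp [hn m hlt])

theorem machine_prefixFree (p q : List Bool) (hp : (machine p).Dom) (hq : (machine q).Dom)
    (h : p <+: q) : p = q := by
  obtain ⟨t, rfl⟩ := h
  have hlt : p.idxOf false < p.length := by
    by_contra hn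
    simp [machine, hn] at hp
  have hmem : false ∈ p := List.idxOf_lt_length_iff.1 hlt
  have hidx : (p ++ t).idxOf false = p.idxOf false := List.idxOf_append_of_mem hmem
  have hlt' : p.idxOf false < (p ++ t).length := by simp; omega
  have hd : (p ++ t).drop (p.idxOf false + 1) = p.drop (p.idxOf false + 1) ++ t :=
    List.drop_append_of_le_length hlt
  simp only [machine, hidx, hd, hlt, hlt', decide_true, cond_true] at hp hq
  have := trim_prefixFree _ _ _ hp hq (List.prefix_append _ _)
  simpa using this

theorem machine_replicate (e : ℕ) (σ : List Bool) :
    machine (List.replicate e true ++ false :: σ) = trim (Denumerable.ofNat Code e) σ := by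
  have hidx : (List.replicate e true ++ false :: σ).idxOf false = e := by
    rw [List.idxOf_append_of_notMem (by simp [List.mem_replicate])]
    simp
  simp only [machine, hidx]
  simp [List.drop_append]

theorem mem_trim_of_mem {M : List Bool →. List Bool} (hM : IsPrefixMachine M) {c : Code}
    (hc : c.eval = fun n => Part.bind (decode (α := List Bool) n) fun a => (M a).map encode)
    {σ y : List Bool} (hy : y ∈ M σ) : y ∈ trim c σ := by
  have key : ∀ τ z k, z ∈ Code.evaln k c (encode τ) → ∃ w ∈ M τ, encode w = z := by
    intro τ z k hz
    have := Code.evaln_sound hz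
    rw [hc] at this
    simpa using this
  have hev : encode y ∈ c.eval (encode σ) := by
    rw [hc]; simpa using hy
  obtain ⟨k, hk⟩ := Code.evaln_complete.1 hev
  have hst : stage c (Nat.pair k (encode σ)) = some (σ, encode y) := by
    simp only [stage, Nat.unpair_pair, encodek, Option.bind_some]
    rw [Option.mem_def.1 hk]; rfl
  have hex : ∃ n, hit c σ n = true :=
    ⟨_, hit_eq.2 ⟨_, hst, comparable_of_prefix (List.prefix_refl σ)⟩⟩
  refine mem_trim.2 ⟨Nat.find hex, Nat.find_spec hex, fun m hm => ?_, ?_⟩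
  · simpa using Nat.find_min hex hm
  · obtain ⟨⟨τ, z⟩, ht, hcomp⟩ := hit_eq.1 (Nat.find_spec hex)
    have ht' := ht
    simp only [stage, Option.bind_eq_some_iff, Option.map_eq_some_iff] at ht'
    obtain ⟨τ', -, z', hz', he⟩ := ht'
    simp only [Prod.mk.injEq] at he
    obtain ⟨rfl, rfl⟩ := he
    obtain ⟨w, hw, hwz⟩ := key _ _ _ hz'
    have hdτ : (M τ').Dom := Part.dom_iff_mem.2 ⟨w, hw⟩
    have hdσ : (M σ).Dom := Part.dom_iff_mem.2 ⟨y, hy⟩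
    have hτσ : τ' = σ := by
      rcases prefix_of_comparable hcomp with h | h
      · exact hM.prefixFree _ _ hdτ hdσ h
      · exact (hM.prefixFree _ _ hdσ hdτ h).symm
    subst hτσ
    obtain rfl := Part.mem_unique hw hy
    exact mem_output.2 ⟨_, ht, by rw [← hwz, encodek]⟩

/-- Universal prefix-free machines exist. -/
theorem isUniversalPrefixMachine_machine : IsUniversalPrefixMachine machine where
  isPrefixMachine := ⟨machine_partrec, machine_prefixFree⟩
  optimal := by
    intro M hM
    obtain ⟨c, hc⟩ := Code.exists_code.1 hM.partrec
    refine ⟨encode c + 1, fun σ => ?_⟩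
    rcases eq_or_ne (complexity M σ) ⊤ with htop | htop
    · simp [htop]
    · have hne : Nonempty {p : List Bool // σ ∈ M p} := by
        by_contra hn
        refine htop (iInf₂_eq_top.2 fun p hp => absurd ⟨⟨p, hp⟩⟩ hn)
      obtain ⟨⟨p, hp⟩, hpe⟩ := ENat.exists_eq_iInf
        (fun p : {p : List Bool // σ ∈ M p} => (p.1.length : ℕ∞))
      have hcM : complexity M σ = p.length := by
        rw [complexity, iInf_subtype']; exact hpe.symm
      rw [hcM]
      have hm : σ ∈ machine (List.replicate (encode c) true ++ false :: p) := by
        rw [machine_replicate, Denumerable.ofNat_encode]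
        exact mem_trim_of_mem hM hc hp
      have hle : complexity machine σ ≤
          ((List.replicate (encode c) true ++ false :: p).length : ℕ∞) :=
        iInf₂_le (f := fun (q : List Bool) (_ : σ ∈ machine q) => (q.length : ℕ∞)) _ hm
      refine hle.trans ?_
      simp only [List.length_append, List.length_replicate, List.length_cons]
      exact_mod_cast (by omega)

end UniversalMachine

/-!
Choose a computable, strictly increasing sequence `c` such that the tail of `∑ u k ^ 2` from `c j` on
is at most `16 ^ (-j)`. By Kolmogorov's maximal inequality (`count_partialSum_gt_mul_sq_le`), among
the `2 ^ c (j + 1)` sign patterns of length `c (j + 1)` a proportion of at most `4 ^ (-j)` lets some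
partial sum of the `j`-th block `c j ≤ k < c (j + 1)` exceed `2 ^ (-j)` in absolute value.

Since `u` is a computable sequence, the block sums can be rounded to integers at a fixed scale, and
then it is decidable whether one of the rounded sums is large (`exists_computable_exceedance`). The
patterns that fail this test for `j` still form a proportion of at most `4 ^ (-j)`, so such a pattern
is described by `j` in unary followed by its rank among all failing patterns, which takes
`c (j + 1) - 2 * j` bits. This is a prefix-free description of length `c (j + 1) - j + 1`, and hence
the initial segments of a Kolmogorov–Chaitin complex string pass the test for all large `j`
(`exists_forall_test_eq_false_of_mem_KC`).

For large `j` all partial sums within the `j`-th block are therefore at most `3 * 2 ^ (-j)`. These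
bounds are summable, so the series is Cauchy (`exists_tendsto_sum_of_block_bound`).

Sign patterns of length `n` are represented by the numbers `v < 2 ^ n` through `Nat.testBit`.
-/

/-! ### Kolmogorov's maximal inequality for uniform signs -/

theorem Nat.count_two_mul (p : ℕ → Prop) [DecidablePred p] (n : ℕ) :
    Nat.count p (2 * n) =
      Nat.count (fun w => p (2 * w)) n + Nat.count (fun w => p (2 * w + 1)) n := by
  induction n with
  | zero => simp
  | succ n ih =>
    rw [show 2 * (n + 1) = 2 * n + 1 + 1 by ring]
    simp only [Nat.count_succ, ih]
    ring

theorem rademacher_succ_testBit (v k : ℕ) :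
    rademacher v.testBit (k + 1) = rademacher (v / 2).testBit k := by
  simp [rademacher, Nat.testBit_succ]

open Classical in
/-- Kolmogorov's maximal inequality for `n` uniformly distributed signs, in counting form. The
starting value `x` makes an induction on `n` possible that splits off the first sign: if `t < |x|`
the bound is trivial, and otherwise the claim for `x + u 0` and for `x - u 0` is averaged. -/
theorem count_partialSum_gt_mul_sq_le (n : ℕ) (t : ℝ) (ht : 0 ≤ t) (u : ℕ → ℝ) (x : ℝ) :
    (Nat.count (fun v : ℕ => ∃ m ≤ n,
      t < |x + ∑ k ∈ Finset.range m, rademacher v.testBit k * u k|) (2 ^ n) : ℝ) * t ^ 2 ≤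
      2 ^ n * (x ^ 2 + ∑ k ∈ Finset.range n, u k ^ 2) := by
  induction n generalizing u x with
  | zero =>
    by_cases h : t < |x|
    · have : t ^ 2 ≤ x ^ 2 := by
        rw [← sq_abs x]; gcongr
      simpa [Nat.count_succ, h] using this
    · simp [h, sq_nonneg]
  | succ n ih =>
    by_cases h : t < |x|
    · have hc : (Nat.count (fun v : ℕ => ∃ m ≤ n + 1,
          t < |x + ∑ k ∈ Finset.range m, rademacher v.testBit k * u k|) (2 ^ (n + 1)) : ℝ)
          ≤ 2 ^ (n + 1) := by
        exact_mod_cast Nat.count_le _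
      have hx : t ^ 2 ≤ x ^ 2 := by
        rw [← sq_abs x]; gcongr
      have hs : 0 ≤ ∑ k ∈ Finset.range (n + 1), u k ^ 2 :=
        Finset.sum_nonneg fun k _ => sq_nonneg _
      calc _ ≤ (2 : ℝ) ^ (n + 1) * x ^ 2 := by gcongr
        _ ≤ _ := by gcongr; linarith
    · have key : ∀ (y : ℝ) (v w : ℕ), v / 2 = w → y = rademacher v.testBit 0 →
          ((∃ m ≤ n + 1, t < |x + ∑ k ∈ Finset.range m, rademacher v.testBit k * u k|) ↔
          ∃ m ≤ n, t < |(x + y * u 0) +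
            ∑ k ∈ Finset.range m, rademacher w.testBit k * u (k + 1)|) := by
        rintro y v w rfl rfl
        have hstep : ∀ m, x + ∑ k ∈ Finset.range (m + 1), rademacher v.testBit k * u k =
            (x + rademacher v.testBit 0 * u 0) +
            ∑ k ∈ Finset.range m, rademacher (v / 2).testBit k * u (k + 1) := by
          intro m
          rw [Finset.sum_range_succ']
          simp only [rademacher_succ_testBit]
          ring
        constructor
        · rintro ⟨m, hm, hlt⟩
          cases m with
          | zero => simp [h] at hlt
          | succ m => exact ⟨m, by omega, by rw [← hstep]; exact hlt⟩
        · rintro ⟨m, hm, hlt⟩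
          exact ⟨m + 1, by omega, by rw [hstep]; exact hlt⟩
      have h0 : ∀ w : ℕ, (-1 : ℝ) = rademacher (2 * w).testBit 0 := by
        intro w; simp [rademacher]
      have h1 : ∀ w : ℕ, (1 : ℝ) = rademacher (2 * w + 1).testBit 0 := by
        intro w; simp [rademacher, Nat.add_mod]
      rw [pow_succ' 2 n, Nat.count_two_mul]
      simp only [fun w => key _ (2 * w) w (by omega) (h0 w),
        fun w => key _ (2 * w + 1) w (by omega) (h1 w)]
      have i0 := ih (fun k => u (k + 1)) (x + -1 * u 0)
      have i1 := ih (fun k => u (k + 1)) (x + 1 * u 0)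
      rw [Finset.sum_range_succ']
      push_cast
      rw [add_mul]
      refine (add_le_add i0 i1).trans (le_of_eq ?_)
      ring

/-- The form of the maximal inequality used for the `j`-th block: threshold `2 ^ (-j)`, and sum of
squares at most `16 ^ (-j)`. -/
theorem count_mul_four_pow_le {u : ℕ → ℝ} {n j : ℕ} {p : ℕ → Prop} [DecidablePred p]
    (hp : ∀ v, p v → ∃ m ≤ n,
      (1 / 2) ^ j < |∑ k ∈ Finset.range m, rademacher v.testBit k * u k|)
    (hu : ∑ k ∈ Finset.range n, u k ^ 2 ≤ 1 / 16 ^ j) :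
    Nat.count p (2 ^ n) * 4 ^ j ≤ 2 ^ n := by
  classical
  have h := count_partialSum_gt_mul_sq_le n ((1 / 2) ^ j) (by positivity) u 0
  simp only [zero_add, ne_eq, OfNat.ofNat_ne_zero, not_false_eq_true, zero_pow] at h
  have hmono : (Nat.count p (2 ^ n) : ℝ) ≤ (Nat.count (fun v : ℕ => ∃ m ≤ n,
      (1 / 2) ^ j < |∑ k ∈ Finset.range m, rademacher v.testBit k * u k|) (2 ^ n) : ℝ) := by
    exact_mod_cast Nat.count_mono_left fun v _ => hp v
  have h16 : ((1 / 2 : ℝ) ^ j) ^ 2 * 16 ^ j = 4 ^ j := by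
    rw [← pow_mul, mul_comm j 2, pow_mul, ← mul_pow]; norm_num
  have h1 : (Nat.count p (2 ^ n) : ℝ) * ((1 / 2) ^ j) ^ 2 ≤ 2 ^ n * (1 / 16 ^ j) :=
    (mul_le_mul_of_nonneg_right hmono (by positivity)).trans
      (h.trans (mul_le_mul_of_nonneg_left hu (by positivity)))
  have h2 : (Nat.count p (2 ^ n) : ℝ) * 4 ^ j ≤ 2 ^ n := by
    rw [← h16, ← mul_assoc]
    calc _ ≤ (2 : ℝ) ^ n * (1 / 16 ^ j) * 16 ^ j := by gcongr
      _ = 2 ^ n := by field_simp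
  exact_mod_cast h2

/-! ### Computability of sums, counting and bit strings -/

theorem Primrec.nat_pow_left (b : ℕ) : Primrec fun n : ℕ => b ^ n :=
  (Primrec.nat_rec₁ (f := fun _ y => b * y) 1
    (Primrec.nat_mul.comp (Primrec.const b) Primrec.snd)).of_eq fun n => by
      induction n with
      | zero => rfl
      | succ n ih => simp only [ih]; ring

theorem Primrec.nat_testBit : Primrec₂ Nat.testBit :=
  (Primrec.eq.decide.comp
    (Primrec.nat_mod.comp
      (Primrec.nat_div.comp Primrec.fst ((Primrec.nat_pow_left 2).comp Primrec.snd))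
      (Primrec.const 2))
    (Primrec.const 1)).of_eq fun x => by
      simp [Nat.testBit_eq_decide_div_mod_eq]

theorem Computable.sum_range {α : Type*} [Primcodable α] {f : α → ℕ → ℕ} {g : α → ℕ}
    (hf : Computable₂ f) (hg : Computable g) :
    Computable fun a => ∑ k ∈ Finset.range (g a), f a k := by
  refine (Computable.nat_rec (h := fun a p => p.2 + f a p.1) hg (Computable.const 0)
    (Primrec.nat_add.to_comp.comp (Computable.snd.comp Computable.snd)
      (hf.comp Computable.fst (Computable.fst.comp Computable.snd)))).of_eq fun a => ?_
  induction g a with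
  | zero => rfl
  | succ n ih => rw [Finset.sum_range_succ, ← ih]

theorem Computable.nat_count {α : Type*} [Primcodable α] {p : α → ℕ → Bool} {g : α → ℕ}
    (hp : Computable₂ p) (hg : Computable g) :
    Computable fun a => Nat.count (fun k => p a k = true) (g a) := by
  refine (Computable.sum_range (f := fun a k => bif p a k then 1 else 0)
    (Computable.cond hp (Computable.const 1) (Computable.const 0)) hg).of_eq fun a => ?_
  rw [Nat.count_eq_card_filter_range, Finset.card_filter]
  exact Finset.sum_congr rfl fun k _ => Bool.cond_eq_ite _ _ _

theorem initialSegment_testBit_computable : Computable₂ fun v n : ℕ => initialSegment v.testBit n :=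
  (Primrec.list_map (f := fun x : ℕ × ℕ => List.range x.2) (g := fun x k => x.1.testBit k)
    (Primrec.list_range.comp Primrec.snd)
    (Primrec.nat_testBit.comp (Primrec.fst.comp Primrec.fst) Primrec.snd)).to_comp

theorem replicate_true_computable : Computable fun n : ℕ => List.replicate n true :=
  (Primrec.list_map (g := fun _ _ => true) Primrec.list_range
    (Primrec.const true)).to_comp.of_eq fun n => by simp

/-! ### Compression by prefix-free machines -/

theorem initialSegment_length (α : ℕ → Bool) (n : ℕ) : (initialSegment α n).length = n := by
  simp [initialSegment]

theorem initialSegment_eq_iff {α β : ℕ → Bool} {n : ℕ} :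
    initialSegment α n = initialSegment β n ↔ ∀ k < n, α k = β k := by
  simp [initialSegment]

theorem initialSegment_testBit_injective {v w n : ℕ} (hv : v < 2 ^ n) (hw : w < 2 ^ n)
    (h : initialSegment v.testBit n = initialSegment w.testBit n) : v = w := by
  rw [initialSegment_eq_iff] at h
  refine Nat.eq_of_testBit_eq fun i => ?_
  rcases lt_or_ge i n with hi | hi
  · exact h i hi
  · have hp : 2 ^ n ≤ 2 ^ i := Nat.pow_le_pow_right (by norm_num) hi
    rw [Nat.testBit_lt_two_pow (hv.trans_le hp), Nat.testBit_lt_two_pow (hw.trans_le hp)]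

/-- Coding theorem for an explicit prefix-free set of programs: if the programs `prog x`, for `x`
in the computable set `R`, are computable, distinct and form a prefix-free set, then `out x` has
complexity at most the length of `prog x`, up to a constant. The machine searches for the `x` that
belongs to its input and outputs `out x`. -/
theorem exists_complexity_le_length {U : List Bool →. List Bool}
    (hU : IsUniversalPrefixMachine U) {R : ℕ → Bool} {prog out : ℕ → List Bool}
    (hR : Computable R) (hprog : Computable prog) (hout : Computable out)
    (hfree : ∀ x y, R x = true → R y = true → prog x <+: prog y → x = y) :
    ∃ c : ℕ, ∀ x, R x = true → complexity U (out x) ≤ (prog x).length + c := by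
  let M : List Bool →. List Bool := fun p =>
    (Nat.rfind fun x => Part.some (R x && decide (prog x = p))).map out
  have hmem : ∀ p y, y ∈ M p → ∃ x, R x = true ∧ prog x = p ∧ out x = y := by
    intro p y hy
    obtain ⟨x, hx, rfl⟩ := (Part.mem_map_iff _).1 hy
    have := Nat.rfind_spec hx
    simp only [Part.mem_some_iff, Bool.true_eq, Bool.and_eq_true, decide_eq_true_eq] at this
    exact ⟨x, this.1, this.2, rfl⟩
  have hM : IsPrefixMachine M := by
    refine ⟨?_, ?_⟩
    · have h1 : Computable₂ fun (p : List Bool) (x : ℕ) => (R x && decide (prog x = p)) :=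
        Primrec.and.to_comp.comp (hR.comp Computable.snd)
          (Primrec.eq.decide.to_comp.comp (hprog.comp Computable.snd) Computable.fst)
      exact (Partrec.rfind h1.partrec₂).map (hout.comp Computable.snd)
    · intro p q hp hq hpq
      obtain ⟨a, ha⟩ := Part.dom_iff_mem.1 hp
      obtain ⟨b, hb⟩ := Part.dom_iff_mem.1 hq
      obtain ⟨x, hx, rfl, -⟩ := hmem _ _ ha
      obtain ⟨y, hy, rfl, -⟩ := hmem _ _ hb
      rw [hfree x y hx hy hpq]
  obtain ⟨c, hc⟩ := hU.optimal M hM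
  refine ⟨c, fun x hx => (hc _).trans ?_⟩
  gcongr
  have hdom : (M (prog x)).Dom := by
    have : (Nat.rfind fun y => Part.some (R y && decide (prog y = prog x))).Dom :=
      Nat.rfind_dom.2 ⟨x, by simp [hx], fun _ => trivial⟩
    exact this
  obtain ⟨y, hy⟩ := Part.dom_iff_mem.1 hdom
  obtain ⟨x', hx', he, rfl⟩ := hmem _ _ hy
  obtain rfl := hfree _ _ hx' hx (he ▸ List.prefix_refl _)
  exact iInf₂_le (f := fun (q : List Bool) (_ : out x' ∈ M q) => (q.length : ℕ∞)) _ hy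

theorem eq_of_replicate_append_prefix {i j : ℕ} {σ τ : List Bool}
    (h : List.replicate i true ++ false :: σ <+: List.replicate j true ++ false :: τ) :
    i = j ∧ σ <+: τ := by
  induction i generalizing j with
  | zero =>
    cases j with
    | zero => simpa using h
    | succ j => simp [List.replicate_succ] at h
  | succ i ih =>
    cases j with
    | zero => simp [List.replicate_succ] at h
    | succ j => simpa using ih (j := j) (by simpa [List.replicate_succ] using h)

/-- A Kolmogorov–Chaitin complex string passes all but finitely many of the tests `P j` of a
computable sequence, where `P j` rejects at most a proportion of `4 ^ (-j)` of the strings of length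
`len j`. A rejected string is described by `j` in unary and its rank among the rejected strings. -/
theorem exists_forall_test_eq_false_of_mem_KC {U : List Bool →. List Bool}
    (hU : IsUniversalPrefixMachine U) {P : ℕ → ℕ → Bool} {len : ℕ → ℕ} (hP : Computable₂ P)
    (hlen : Computable len)
    (hcount : ∀ j, Nat.count (fun v => P j v = true) (2 ^ len j) * 4 ^ j ≤ 2 ^ len j)
    {α : ℕ → Bool} (hα : α ∈ KC U) :
    ∃ J, ∀ j ≥ J, ∀ v < 2 ^ len j, (∀ k < len j, v.testBit k = α k) → P j v = false := by
  -- A number `x` codes the pair of the level `j = x.unpair.1` and the string `v = x.unpair.2`.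
  let rank : ℕ → ℕ := fun x => Nat.count (fun v => P x.unpair.1 v = true) x.unpair.2
  let R : ℕ → Bool := fun x =>
    P x.unpair.1 x.unpair.2 && decide (x.unpair.2 < 2 ^ len x.unpair.1)
  let prog : ℕ → List Bool := fun x => List.replicate x.unpair.1 true ++
    false :: initialSegment (rank x).testBit (len x.unpair.1 - 2 * x.unpair.1)
  let out : ℕ → List Bool := fun x => initialSegment x.unpair.2.testBit (len x.unpair.1)
  have h1 : Computable fun x : ℕ => x.unpair.1 := Computable.fst.comp Computable.unpair
  have h2 : Computable fun x : ℕ => x.unpair.2 := Computable.snd.comp Computable.unpair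
  have hl : Computable fun x : ℕ => len x.unpair.1 := hlen.comp h1
  have hrank : Computable rank :=
    Computable.nat_count (p := fun x v => P (Nat.unpair x).1 v)
      (hP.comp (h1.comp Computable.fst) Computable.snd) h2
  have hR : Computable R := Primrec.and.to_comp.comp (hP.comp h1 h2)
    (Primrec.nat_lt.decide.to_comp.comp h2 ((Primrec.nat_pow_left 2).to_comp.comp hl))
  have hprog : Computable prog := Computable.list_append.comp (replicate_true_computable.comp h1)
    (Computable.list_cons.comp (Computable.const false)
      (initialSegment_testBit_computable.comp hrank (Primrec.nat_sub.to_comp.comp hl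
        (Primrec.nat_mul.to_comp.comp (Computable.const 2) h1))))
  have hout : Computable out := initialSegment_testBit_computable.comp h2 hl
  have hRiff : ∀ x, R x = true ↔
      P x.unpair.1 x.unpair.2 = true ∧ x.unpair.2 < 2 ^ len x.unpair.1 := by
    intro x; simp [R]
  -- A rejected string exists only if `2 * j ≤ len j`, so no subtraction is truncated.
  have hle : ∀ x, R x = true → 2 * x.unpair.1 ≤ len x.unpair.1 ∧
      rank x < 2 ^ (len x.unpair.1 - 2 * x.unpair.1) := by
    intro x hx
    rw [hRiff] at hx
    set j := x.unpair.1
    have hlt : rank x < Nat.count (fun v => P j v = true) (2 ^ len j) :=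
      Nat.count_strict_mono hx.1 hx.2
    have hc := hcount j
    have h4 : (4 : ℕ) ^ j = 2 ^ (2 * j) := by rw [pow_mul]; norm_num
    rw [h4] at hc
    have hj : 2 * j ≤ len j := by
      refine (Nat.pow_le_pow_iff_right (a := 2) (by norm_num)).1 (le_trans ?_ hc)
      exact Nat.le_mul_of_pos_left _ (by omega)
    refine ⟨hj, hlt.trans_le ?_⟩
    refine Nat.le_of_mul_le_mul_right (c := 2 ^ (2 * j)) ?_ (by positivity)
    rwa [← pow_add, Nat.sub_add_cancel hj]
  have hfree : ∀ x y, R x = true → R y = true → prog x <+: prog y → x = y := by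
    intro x y hx hy hxy
    obtain ⟨he, hpre⟩ := eq_of_replicate_append_prefix hxy
    have hrx := (hle x hx).2
    have hry := (hle y hy).2
    rw [← he] at hry hpre
    have hr := initialSegment_testBit_injective hrx hry
      (hpre.eq_of_length (by simp only [initialSegment_length]))
    rw [hRiff] at hx hy
    have hv : x.unpair.2 = y.unpair.2 := by
      refine Nat.count_injective (p := fun v => P x.unpair.1 v = true) hx.1 (he ▸ hy.1) ?_
      simp only [rank, ← he] at hr
      exact hr
    rw [← Nat.pair_unpair x, ← Nat.pair_unpair y, he, hv]
  obtain ⟨c, hc⟩ := exists_complexity_le_length hU hR hprog hout hfree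
  obtain ⟨k, hk⟩ := hα
  -- From `len j ≤ (j + 1 + (len j - 2 * j)) + c + k` it follows that `j ≤ c + k + 1`.
  refine ⟨c + k + 2, fun j hj v hv hvα => ?_⟩
  by_contra hne
  have hx : R (Nat.pair j v) = true := by
    rw [hRiff]; simp only [Nat.unpair_pair]; exact ⟨by simpa using hne, hv⟩
  have h2j := (hle _ hx).1
  have hcx := hc _ hx
  have ho : out (Nat.pair j v) = initialSegment α (len j) := by
    simp only [out, Nat.unpair_pair]
    exact initialSegment_eq_iff.2 hvα
  have hlenp : (prog (Nat.pair j v)).length = j + (len j - 2 * j + 1) := by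
    simp [prog, initialSegment_length]
  rw [ho, hlenp] at hcx
  simp only [Nat.unpair_pair] at h2j
  have hfin : (len j : ℕ∞) ≤ ((j + (len j - 2 * j + 1) + c + k : ℕ) : ℕ∞) := by
    refine (hk (len j)).trans ?_
    push_cast at hcx ⊢
    gcongr
  have := Nat.cast_le.1 hfin
  omega

/-! ### Deciding whether integer partial sums are large -/

/-- It is decidable, uniformly in `j` and `v`, whether a signed sum of the integers
`(-1) ^ s j k * w j k` over an initial segment of length at most `len j` exceeds `T j` in absolute
value. -/
theorem exists_computable_exceedance {w s : ℕ → ℕ → ℕ} {len T : ℕ → ℕ} (hw : Computable₂ w)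
    (hs : Computable₂ s) (hlen : Computable len) (hT : Computable T) :
    ∃ P : ℕ → ℕ → Bool, Computable₂ P ∧ ∀ j v, P j v = true ↔ ∃ m ≤ len j, (T j : ℝ) <
      |∑ k ∈ Finset.range m, rademacher v.testBit k * ((-1) ^ s j k * (w j k : ℝ))| := by
  -- `A` collects the terms with positive sign and `B` those with negative sign, so that all
  -- computations take place in `ℕ`.
  let pos : ℕ × ℕ → ℕ → Bool := fun x k => x.2.testBit k == decide (s x.1 k % 2 = 0)
  let A : ℕ × ℕ → ℕ → ℕ := fun x m =>
    ∑ k ∈ Finset.range m, bif pos x k then w x.1 k else 0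
  let B : ℕ × ℕ → ℕ → ℕ := fun x m =>
    ∑ k ∈ Finset.range m, bif pos x k then 0 else w x.1 k
  let C : ℕ × ℕ → ℕ → Bool := fun x m =>
    decide (B x m + T x.1 < A x m) || decide (A x m + T x.1 < B x m)
  have hpos : Computable₂ pos := Primrec.beq.to_comp.comp
    (Primrec.nat_testBit.to_comp.comp (Computable.snd.comp Computable.fst) Computable.snd)
    ((Primrec.eq.decide.comp (Primrec.nat_mod.comp Primrec.id (Primrec.const 2))
      (Primrec.const 0)).to_comp.comp
      (hs.comp (Computable.fst.comp Computable.fst) Computable.snd))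
  have hw' : Computable₂ fun (x : ℕ × ℕ) k => w x.1 k :=
    hw.comp (Computable.fst.comp Computable.fst) Computable.snd
  have hcomp : ∀ {f : ℕ × ℕ → ℕ → ℕ}, Computable₂ f →
      Computable₂ fun x m => ∑ k ∈ Finset.range m, f x k := fun hf =>
    Computable.sum_range (f := fun (y : (ℕ × ℕ) × ℕ) k => _)
      (hf.comp (Computable.fst.comp Computable.fst) Computable.snd) Computable.snd
  have hA : Computable₂ A := hcomp (Computable.cond hpos hw' (Computable.const 0))
  have hB : Computable₂ B := hcomp (Computable.cond hpos (Computable.const 0) hw')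
  have hTx : Computable fun y : (ℕ × ℕ) × ℕ => T y.1.1 :=
    hT.comp (Computable.fst.comp Computable.fst)
  have hC : Computable₂ C := Primrec.or.to_comp.comp
    (Primrec.nat_lt.decide.to_comp.comp (Primrec.nat_add.to_comp.comp hB hTx) hA)
    (Primrec.nat_lt.decide.to_comp.comp (Primrec.nat_add.to_comp.comp hA hTx) hB)
  have hdiff : ∀ x m, ∑ k ∈ Finset.range m, rademacher (Nat.testBit x.2) k *
      ((-1) ^ s x.1 k * (w x.1 k : ℝ)) = (A x m : ℝ) - B x m := by
    intro x m
    simp only [A, B]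
    push_cast
    rw [← Finset.sum_sub_distrib]
    refine Finset.sum_congr rfl fun k _ => ?_
    rcases Nat.even_or_odd (s x.1 k) with he | ho
    · cases hb : x.2.testBit k <;> simp [rademacher, pos, hb, he.neg_one_pow, Nat.even_iff.1 he]
    · cases hb : x.2.testBit k <;> simp [rademacher, pos, hb, ho.neg_one_pow, Nat.odd_iff.1 ho]
  have hCiff : ∀ x m, C x m = true ↔ (T x.1 : ℝ) < |(A x m : ℝ) - B x m| := by
    intro x m
    simp only [C, Bool.or_eq_true, decide_eq_true_eq, lt_abs, lt_sub_iff_add_lt, neg_sub]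
    norm_cast
    simp only [add_comm]
  refine ⟨fun j v => decide (0 < Nat.count (fun m => C (j, v) m = true) (len j + 1)),
    Primrec.nat_lt.decide.to_comp.comp (Computable.const 0)
      (Computable.nat_count hC (Computable.succ.comp (hlen.comp Computable.fst))), fun j v => ?_⟩
  simp only [decide_eq_true_eq, hdiff (j, v), Nat.count_eq_card_filter_range, Finset.card_pos,
    Finset.Nonempty, Finset.mem_filter, Finset.mem_range, Nat.lt_succ_iff, hCiff]

/-! ### Rounding -/

theorem abs_rademacher (α : ℕ → Bool) (k : ℕ) : |rademacher α k| = 1 := by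
  unfold rademacher; split <;> simp

/-- Rounding the approximation `(-1) ^ s * a / b` of `x` to a multiple of `2 ^ (-p)` doubles the
error bound; the claim is scaled by `2 ^ p`. -/
theorem abs_floor_sub_le {s a b p : ℕ} {x : ℝ} (hb : b ≠ 0)
    (h : |(-1 : ℝ) ^ s * a / b - x| ≤ 1 / 2 ^ p) :
    |(-1 : ℝ) ^ s * ((a * 2 ^ p / b : ℕ) : ℝ) - 2 ^ p * x| ≤ 2 := by
  have hb' : (0 : ℝ) < b := by positivity
  have h1 : |((a * 2 ^ p / b : ℕ) : ℝ) - a * 2 ^ p / b| ≤ 1 := by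
    have hle : ((a * 2 ^ p / b : ℕ) : ℝ) ≤ a * 2 ^ p / b := by
      exact_mod_cast Nat.cast_div_le (α := ℝ) (m := a * 2 ^ p) (n := b)
    have hlt : (a : ℝ) * 2 ^ p / b < ((a * 2 ^ p / b : ℕ) : ℝ) + 1 := by
      rw [div_lt_iff₀ hb']
      exact_mod_cast Nat.lt_mul_of_div_lt (Nat.lt_succ_self (a * 2 ^ p / b)) (Nat.pos_of_ne_zero hb)
    rw [abs_le]; constructor <;> linarith
  have h2 : |2 ^ p * ((-1 : ℝ) ^ s * a / b - x)| ≤ 1 := by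
    rw [abs_mul, abs_of_pos (by positivity : (0 : ℝ) < 2 ^ p)]
    calc _ ≤ (2 : ℝ) ^ p * (1 / 2 ^ p) := by gcongr
      _ = 1 := by field_simp
  calc _ = |(-1 : ℝ) ^ s * (((a * 2 ^ p / b : ℕ) : ℝ) - a * 2 ^ p / b) +
        2 ^ p * ((-1 : ℝ) ^ s * a / b - x)| := by congr 1; ring
    _ ≤ |(-1 : ℝ) ^ s * (((a * 2 ^ p / b : ℕ) : ℝ) - a * 2 ^ p / b)| +
        |2 ^ p * ((-1 : ℝ) ^ s * a / b - x)| := abs_add_le _ _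
    _ ≤ 1 + 1 := by
      gcongr
      rwa [abs_mul, abs_pow, abs_neg, abs_one, one_pow, one_mul]
    _ = 2 := by norm_num

theorem abs_sum_rademacher_sub_le {α : ℕ → Bool} {x y : ℕ → ℝ} {δ : ℝ} {m : ℕ}
    (h : ∀ k < m, |x k - y k| ≤ δ) :
    |∑ k ∈ Finset.range m, rademacher α k * x k - ∑ k ∈ Finset.range m, rademacher α k * y k|
      ≤ m * δ := by
  rw [← Finset.sum_sub_distrib]
  refine (Finset.abs_sum_le_sum_abs _ _).trans ?_
  refine (Finset.sum_le_card_nsmul _ _ δ fun k hk => ?_).trans (by simp)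
  rw [← mul_sub, abs_mul, abs_rademacher, one_mul]
  exact h k (Finset.mem_range.1 hk)

/-! ### Blocks -/

/-- The ends of the blocks can be computed from a modulus of convergence `N` of `∑ u k ^ 2`. -/
theorem exists_strictMono_computable_tail {u : ℕ → ℝ} (hu : Summable fun k => u k ^ 2)
    {N : ℕ → ℕ} (hN : Computable N)
    (h : ∀ m : ℕ, 1 ≤ m →
      |(∑' k, u k ^ 2) - ∑ k ∈ Finset.range (N m), u k ^ 2| < 1 / (m : ℝ)) :
    ∃ c : ℕ → ℕ, Computable c ∧ StrictMono c ∧ ∀ j n,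
      ∑ k ∈ Finset.range n, (if k < c j then 0 else u k) ^ 2 ≤ 1 / 16 ^ j := by
  -- Summing the moduli makes the sequence strictly increasing.
  let c : ℕ → ℕ := fun j => ∑ i ∈ Finset.range (j + 1), (N (16 ^ i) + 1)
  refine ⟨c, ?_, ?_, ?_⟩
  · exact Computable.sum_range (f := fun (_ i : ℕ) => N (16 ^ i) + 1)
      (Computable.succ.comp (hN.comp ((Primrec.nat_pow_left 16).to_comp.comp Computable.snd)))
      Computable.succ
  · refine strictMono_nat_of_lt_succ fun j => ?_
    simp only [c]
    rw [Finset.sum_range_succ _ (j + 1)]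
    omega
  · intro j n
    have hNc : N (16 ^ j) ≤ c j := by
      simp only [c]
      rw [Finset.sum_range_succ]
      omega
    have hsum : ∑ k ∈ Finset.range n, (if k < c j then 0 else u k) ^ 2 +
        ∑ k ∈ Finset.range (N (16 ^ j)), u k ^ 2 ≤ ∑' k, u k ^ 2 := by
      have hle : ∑ k ∈ Finset.range n, (if k < c j then 0 else u k) ^ 2 ≤
          ∑ k ∈ Finset.range n \ Finset.range (c j), u k ^ 2 := by
        rw [← Finset.sum_filter_add_sum_filter_not (Finset.range n) (fun k => k < c j)]
        refine le_of_eq ?_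
        rw [Finset.sum_eq_zero, zero_add]
        · refine Finset.sum_congr (by ext; simp) fun k hk => ?_
          rw [if_neg]
          simpa using (Finset.mem_sdiff.1 hk).2
        · intro k hk
          simp [(Finset.mem_filter.1 hk).2]
      refine (add_le_add_left hle _).trans ?_
      rw [← Finset.sum_union]
      · exact hu.sum_le_tsum _ fun k _ => sq_nonneg _
      · rw [Finset.disjoint_left]
        intro k hk hk'
        simp only [Finset.mem_sdiff, Finset.mem_range] at hk hk'
        omega
    have := (abs_lt.1 (h (16 ^ j) (Nat.one_le_pow _ _ (by norm_num)))).2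
    push_cast at this
    linarith

/-- A series converges if, in all late blocks `c j ≤ k < c (j + 1)`, the partial sums that start at
`c j` are bounded by `C * 2 ^ (-j)`. The terms before the block are replaced by `0`. -/
theorem exists_tendsto_sum_of_block_bound {f : ℕ → ℝ} {c : ℕ → ℕ} (hc : StrictMono c) {J : ℕ}
    {C : ℝ} (h : ∀ j ≥ J, ∀ m ≤ c (j + 1),
      |∑ k ∈ Finset.range m, if k < c j then 0 else f k| ≤ C * (1 / 2) ^ j) :
    ∃ s : ℝ, Tendsto (fun n => ∑ k ∈ Finset.range n, f k) atTop (𝓝 s) := by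
  have hblock : ∀ j ≥ J, ∀ m, c j ≤ m → m ≤ c (j + 1) →
      dist (∑ k ∈ Finset.range (c j), f k) (∑ k ∈ Finset.range m, f k) ≤ C * (1 / 2) ^ j := by
    intro j hj m hm hm'
    rw [dist_comm, Real.dist_eq]
    convert h j hj m hm' using 2
    rw [← Finset.sum_range_add_sum_Ico _ hm, ← Finset.sum_range_add_sum_Ico _ hm,
      Finset.sum_eq_zero (s := Finset.range (c j)) (f := fun k => if k < c j then 0 else f k)
        (fun k hk => if_pos (Finset.mem_range.1 hk)), add_sub_cancel_left, zero_add]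
    exact Finset.sum_congr rfl fun k hk => (if_neg (by simpa using (Finset.mem_Ico.1 hk).1)).symm
  have hcauchy : CauchySeq fun i => ∑ k ∈ Finset.range (c (i + J)), f k := by
    refine cauchySeq_of_le_geometric (1 / 2) (C * (1 / 2) ^ J) (by norm_num) fun i => ?_
    refine (hblock (i + J) (by omega) (c (i + 1 + J)) (hc.monotone (by omega))
      (by rw [add_right_comm])).trans (le_of_eq ?_)
    rw [pow_add]; ring
  obtain ⟨s, hs⟩ := cauchySeq_tendsto_of_complete hcauchy
  refine ⟨s, ?_⟩
  have hs' : Tendsto (fun j => ∑ k ∈ Finset.range (c j), f k) atTop (𝓝 s) :=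
    (tendsto_add_atTop_iff_nat (f := fun j => ∑ k ∈ Finset.range (c j), f k) J).1 hs
  have hgeom : Tendsto (fun j : ℕ => C * (1 / 2 : ℝ) ^ j) atTop (𝓝 0) := by
    simpa using (tendsto_pow_atTop_nhds_zero_of_lt_one (by norm_num : (0 : ℝ) ≤ 1 / 2)
      (by norm_num)).const_mul C
  rw [Metric.tendsto_atTop] at hs' hgeom ⊢
  intro e he
  obtain ⟨J₁, hJ₁⟩ := hs' (e / 2) (half_pos he)
  obtain ⟨J₂, hJ₂⟩ := hgeom (e / 2) (half_pos he)
  refine ⟨c (max J (max J₁ J₂)), fun n hn => ?_⟩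
  have hex : ∃ j, n < c (j + 1) := ⟨n, (Nat.lt_succ_self n).trans_le (hc.le_apply)⟩
  obtain ⟨j, hj, hj'⟩ : ∃ j, c j ≤ n ∧ n < c (j + 1) := by
    refine ⟨Nat.find hex, ?_, Nat.find_spec hex⟩
    rcases hz : Nat.find hex with _ | i
    · exact (hc.monotone (Nat.zero_le _)).trans hn
    · exact not_lt.1 (Nat.find_min hex (by omega : i < Nat.find hex))
  have hjJ : max J (max J₁ J₂) ≤ j := Nat.lt_succ_iff.1 (hc.lt_iff_lt.1 (hn.trans_lt hj'))
  have b₁ := hblock j (by omega) n hj hj'.le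
  have b₂ := hJ₂ j (by omega)
  rw [Real.dist_eq, sub_zero] at b₂
  have b₃ := hJ₁ j (by omega)
  have b₄ := (le_abs_self _).trans_lt b₂
  rw [dist_comm] at b₁
  linarith [dist_triangle (∑ k ∈ Finset.range n, f k) (∑ k ∈ Finset.range (c j), f k) s]

/-! ### Convergence of the random series -/

theorem mainTheorem4 (U : List Bool →. List Bool) (hU : IsUniversalPrefixMachine U)
    (u : ℕ → ℝ) (hu : IsSquareComputable u)
    (ε : ℕ → ℝ) (hε : IsAlgorithmicallyRandomRademacher U ε) :
    ∃ s : ℝ, Tendsto (fun N : ℕ => ∑ n ∈ Finset.range N, ε n * u n) atTop (𝓝 s) := by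
  obtain ⟨⟨s, a, b, hs, ha, hb, happ⟩, hsum, N, hN, hNapp⟩ := hu
  obtain ⟨α, hα, hεα⟩ := hε
  obtain ⟨c, hc, hcmono, htail⟩ := exists_strictMono_computable_tail hsum hN hNapp
  let len : ℕ → ℕ := fun j => c (j + 1)
  -- At this precision `len j` rounding errors of `2 * 2 ^ (-prec j)` add up to at most `2 ^ (-j)`,
  -- since `len j ≤ 2 ^ len j`.
  let prec : ℕ → ℕ := fun j => len j + j + 1
  let x : ℕ → ℕ → ℝ := fun j k => if k < c j then 0 else u k
  -- `y j k` is the integer approximation of `2 ^ prec j * x j k`, with absolute value `w j k`.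
  let w : ℕ → ℕ → ℕ := fun j k =>
    bif decide (k < c j) then 0 else a k (prec j) * 2 ^ prec j / b k (prec j)
  let y : ℕ → ℕ → ℝ := fun j k => (-1) ^ s k (prec j) * (w j k : ℝ)
  have hlen : Computable len := hc.comp Computable.succ
  have hprec : Computable prec :=
    Computable.succ.comp (Primrec.nat_add.to_comp.comp hlen Computable.id)
  have hp1 : Computable fun z : ℕ × ℕ => prec z.1 := hprec.comp Computable.fst
  have hw : Computable₂ w := Computable.cond
    (Primrec.nat_lt.decide.to_comp.comp Computable.snd (hc.comp Computable.fst))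
    (Computable.const 0)
    (Primrec.nat_div.to_comp.comp
      (Primrec.nat_mul.to_comp.comp (ha.comp Computable.snd hp1)
        ((Primrec.nat_pow_left 2).to_comp.comp hp1))
      (hb.comp Computable.snd hp1))
  -- The threshold corresponds to `2 * 2 ^ (-j)` after division by `2 ^ prec j`: rejected strings
  -- have a true sum above `2 ^ (-j)`, the others have all true sums at most `3 * 2 ^ (-j)`.
  obtain ⟨P, hP, hPiff⟩ := exists_computable_exceedance (T := fun j => 2 ^ (len j + 2)) hw
    (s := fun j k => s k (prec j)) (hs.comp Computable.snd hp1) hlen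
    ((Primrec.nat_pow_left 2).to_comp.comp
      (Primrec.nat_add.to_comp.comp hlen (Computable.const 2)))
  have hxy : ∀ j k, |y j k - 2 ^ prec j * x j k| ≤ 2 := by
    intro j k
    by_cases hk : k < c j
    · simp [y, w, x, hk]
    · simpa [y, w, x, hk] using abs_floor_sub_le (happ k (prec j)).1 (happ k (prec j)).2
  have hclose : ∀ j m (β : ℕ → Bool), m ≤ len j →
      |∑ k ∈ Finset.range m, rademacher β k * y j k -
        2 ^ prec j * ∑ k ∈ Finset.range m, rademacher β k * x j k| ≤ 2 ^ (len j + 1) := by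
    intro j m β hm
    have h := abs_sum_rademacher_sub_le (α := β) (m := m) fun k _ => hxy j k
    simp only [mul_left_comm _ ((2 : ℝ) ^ prec j), ← Finset.mul_sum] at h
    refine h.trans ?_
    rw [pow_succ]
    gcongr
    exact_mod_cast hm.trans Nat.lt_two_pow_self.le
  have hscale : ∀ j, (2 : ℝ) ^ (len j + 1) = 2 ^ prec j * (1 / 2) ^ j := by
    intro j
    have : prec j = (len j + 1) + j := by simp only [prec]; ring
    rw [this, pow_add _ _ j, mul_assoc, ← mul_pow]
    norm_num
  have hscale' : ∀ j, (2 : ℝ) ^ (len j + 2) = 2 * (2 ^ prec j * (1 / 2) ^ j) := by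
    intro j; rw [← hscale]; ring
  have hprecpos : ∀ j, (0 : ℝ) < 2 ^ prec j := fun j => by positivity
  have hcount : ∀ j, Nat.count (fun v => P j v = true) (2 ^ len j) * 4 ^ j ≤ 2 ^ len j := by
    intro j
    refine count_mul_four_pow_le (u := x j) (fun v hv => ?_) (htail j _)
    obtain ⟨m, hm, hlt⟩ := (hPiff j v).1 hv
    refine ⟨m, hm, ?_⟩
    have h := hclose j m v.testBit hm
    push_cast at hlt
    rw [hscale'] at hlt
    rw [hscale] at h
    have h3 := abs_sub_abs_le_abs_sub (∑ k ∈ Finset.range m, rademacher v.testBit k * y j k)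
      (2 ^ prec j * ∑ k ∈ Finset.range m, rademacher v.testBit k * x j k)
    rw [abs_mul, abs_of_pos (hprecpos j)] at h3
    refine lt_of_mul_lt_mul_left (a := 2 ^ prec j) ?_ (hprecpos j).le
    simp only [y] at h h3
    linarith
  obtain ⟨J, hJ⟩ := exists_forall_test_eq_false_of_mem_KC hU hP hlen hcount hα
  refine exists_tendsto_sum_of_block_bound hcmono (J := J) (C := 3) fun j hj m hm => ?_
  let v := Nat.ofBits fun i : Fin (len j) => α i
  have hv : ∀ k < len j, v.testBit k = α k := fun k hk => Nat.testBit_ofBits_lt _ k hk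
  have hPv := hJ j hj v (Nat.ofBits_lt_two_pow _) hv
  have hnot : ¬ _ := (hPiff j v).not.1 (by simp [hPv])
  push Not at hnot
  have hle := hnot m hm
  have h := hclose j m v.testBit hm
  push_cast at hle
  rw [hscale'] at hle
  rw [hscale] at h
  have h3 := abs_sub_abs_le_abs_sub
    (2 ^ prec j * ∑ k ∈ Finset.range m, rademacher v.testBit k * x j k)
    (∑ k ∈ Finset.range m, rademacher v.testBit k * y j k)
  rw [abs_mul, abs_of_pos (hprecpos j), abs_sub_comm] at h3
  have hterm : ∑ k ∈ Finset.range m, (if k < c j then 0 else ε k * u k) =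
      ∑ k ∈ Finset.range m, rademacher v.testBit k * x j k := by
    refine Finset.sum_congr rfl fun k hk => ?_
    have hk' : k < len j := (Finset.mem_range.1 hk).trans_le hm
    have hr : ε k = rademacher v.testBit k := by rw [hεα, rademacher, rademacher, hv k hk']
    simp only [x, hr, mul_ite, mul_zero]
  rw [hterm]
  refine le_of_mul_le_mul_left (a := 2 ^ prec j) ?_ (hprecpos j)
  simp only [y] at h h3
  linarith
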